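/- Let $(W,S)$ be a finite Coxeter system of rank $n=|S|$, let $T=\{wsw^{-1} : w\in W,\ s\in S\}$ be its set of reflections, and let $\ell(w)$ denote the minimal number of factors in an expression of $w\in W$ as a product of elements of $T$. The absolute order on $W$ is defined by $v\le w$ if and only if $\ell(w)=\ell(v)+\ell(v^{-1}w)$. Let $c\in W$ be any Coxeter element, that is, a conjugate of a product of all elements of $S$, each taken once, in some order, and let $\mathrm{NC}(W)=\mathrm{NC}(W,c)=\{w\in W : w\le c\}$ be the poset of non-crossing partitions, ordered by the absolute order. The Hurwitz graph $H(W)$ is the graph whose vertices are the maximal chains of $\mathrm{NC}(W)$, two of them being joined by an edge if and only if they differ in exactly one element. The radius of a graph is the minimum over its vertices $v$ of the eccentricity $\max_w \mathrm{d}(v,w)$. Then the radius of the Hurwitz graph satisfies $\operatorname{rad}(H(W))\ge\binom{n}{2}$. -/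

import Mathlib

namespace CoxeterSystem

variable {B W : Type*} [Group W] {M : CoxeterMatrix B} (cs : CoxeterSystem M W)

/-- The absolute length (reflection length) of `w`: the word length of `w` with respect to the
set of all reflections, i.e. all conjugates of simple reflections. -/
noncomputable def absLength (w : W) : ℕ :=
  sInf {k | ∃ l : List W, (∀ t ∈ l, cs.IsReflection t) ∧ l.prod = w ∧ l.length = k}

theorem exists_absLength (w : W) :
    ∃ l : List W, (∀ t ∈ l, cs.IsReflection t) ∧ l.prod = w ∧ l.length = cs.absLength w := by
  refine Nat.sInf_mem (s := {k | ∃ l : List W,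
    (∀ t ∈ l, cs.IsReflection t) ∧ l.prod = w ∧ l.length = k}) ?_
  obtain ⟨ω, hω⟩ := cs.wordProd_surjective w
  refine ⟨_, ω.map cs.simple, ?_, hω, rfl⟩
  intro t ht
  obtain ⟨i, -, rfl⟩ := List.mem_map.1 ht
  exact cs.isReflection_simple i

theorem absLength_prod_le (l : List W) (hl : ∀ t ∈ l, cs.IsReflection t) :
    cs.absLength l.prod ≤ l.length :=
  Nat.sInf_le ⟨l, hl, rfl, rfl⟩

theorem absLength_one : cs.absLength 1 = 0 :=
  Nat.le_zero.1 (cs.absLength_prod_le [] (by simp))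

theorem eq_one_of_absLength_eq_zero {w : W} (h : cs.absLength w = 0) : w = 1 := by
  obtain ⟨l, -, rfl, hl⟩ := cs.exists_absLength w
  rw [h] at hl
  simp [List.length_eq_zero_iff.1 hl]

theorem absLength_mul_le (v w : W) : cs.absLength (v * w) ≤ cs.absLength v + cs.absLength w := by
  obtain ⟨l, hl, hv, hlv⟩ := cs.exists_absLength v
  obtain ⟨k, hk, hw, hkw⟩ := cs.exists_absLength w
  have h := cs.absLength_prod_le (l ++ k) (by
    intro t ht
    rcases List.mem_append.1 ht with h | h
    exacts [hl t h, hk t h])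
  rwa [List.prod_append, List.length_append, hv, hw, hlv, hkw] at h

/-- The absolute order on `W`: `v ≤ w` iff `ℓ(w) = ℓ(v) + ℓ(v⁻¹ w)`, where `ℓ` is the absolute
length. -/
def AbsLE (v w : W) : Prop :=
  cs.absLength w = cs.absLength v + cs.absLength (v⁻¹ * w)

theorem AbsLE.rfl (w : W) : cs.AbsLE w w := by
  simp [AbsLE, absLength_one]

theorem AbsLE.trans {u v w : W} (h : cs.AbsLE u v) (h' : cs.AbsLE v w) : cs.AbsLE u w := by
  have h1 := cs.absLength_mul_le (u⁻¹ * v) (v⁻¹ * w)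
  have h2 := cs.absLength_mul_le u (u⁻¹ * w)
  have e1 : u⁻¹ * v * (v⁻¹ * w) = u⁻¹ * w := by group
  have e2 : u * (u⁻¹ * w) = w := by group
  rw [e1] at h1
  rw [e2] at h2
  unfold AbsLE at *
  omega

theorem AbsLE.antisymm {v w : W} (h : cs.AbsLE v w) (h' : cs.AbsLE w v) : v = w := by
  unfold AbsLE at *
  have h0 : cs.absLength (v⁻¹ * w) = 0 := by omega
  exact inv_mul_eq_one.1 (cs.eq_one_of_absLength_eq_zero h0)

/-- A standard Coxeter element: the product of the simple reflections, each taken exactly once,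
in some order. -/
def IsStandardCoxeterElement (c : W) : Prop :=
  ∃ l : List B, l.Nodup ∧ (∀ i : B, i ∈ l) ∧ c = cs.wordProd l

/-- A Coxeter element: a conjugate of a standard Coxeter element. -/
def IsCoxeterElement (c : W) : Prop :=
  ∃ c₀ : W, cs.IsStandardCoxeterElement c₀ ∧ IsConj c₀ c

/-- The non-crossing partitions `NC(W, c)`: the elements below `c` in the absolute order. -/
def NC (c : W) := {w : W // cs.AbsLE w c}

/-- `NC(W, c)` carries the absolute order. -/
instance (c : W) : PartialOrder (cs.NC c) where
  le v w := cs.AbsLE v.1 w.1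
  le_refl v := AbsLE.rfl cs v.1
  le_trans _ _ _ h h' := AbsLE.trans cs h h'
  le_antisymm _ _ h h' := Subtype.ext (AbsLE.antisymm cs h h')

/-- The Hurwitz graph: its vertices are the maximal chains of `NC(W, c)`, and two of them are
adjacent iff they differ in exactly one element, i.e. each contains exactly one element that is
missing from the other. -/
def hurwitzGraph (c : W) : SimpleGraph (Flag (cs.NC c)) where
  Adj C D := ((C : Set (cs.NC c)) \ D).ncard = 1 ∧ ((D : Set (cs.NC c)) \ C).ncard = 1
  symm := ⟨fun _ _ h => ⟨h.2, h.1⟩⟩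
  loopless := ⟨fun _ h => by simp at h⟩

end CoxeterSystem

/-! Over a reflection representation `ρ` of `W` in which `range (ρ c - 1)` has dimension `ℓ(c)`, a
maximal chain `1 = w₀ < w₁ < ⋯ < w_n = c` gives a complete flag of subspaces
`range (ρ w₀ - 1) < ⋯ < range (ρ w_n - 1)`. Any two complete flags have a relative position, a
permutation of `{1, …, n}`, and moving along an edge of the Hurwitz graph changes one step of the
flag, which composes the relative position with at most one adjacent transposition and so changes
its number of inversions by at most one. The chain of the Kreweras complements `wᵢ⁻¹ c` gives the
complementary flag, whose relative position to the original one is the order-reversing permutation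
with all `n.choose 2` inversions.

The geometric representation has `dim range (ρ c - 1) = n` only if its bilinear form is
nondegenerate. In a representation on a larger space in which both the roots and the coroots are
linearly independent this always holds. -/

namespace HurwitzGraph

open Module

section Inversions

open Finset

/-- The inversions of `p` on `{0, …, n - 1}`: the pairs `i < j` whose order `p` reverses. -/
def inversions (n : ℕ) (p : ℕ → ℕ) : Finset (ℕ × ℕ) :=
  {x ∈ range n ×ˢ range n | x.1 < x.2 ∧ p x.2 < p x.1}

theorem mem_inversions {n : ℕ} {p : ℕ → ℕ} {x : ℕ × ℕ} :
    x ∈ inversions n p ↔ (x.1 < n ∧ x.2 < n) ∧ x.1 < x.2 ∧ p x.2 < p x.1 := by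
  simp only [inversions, mem_filter, mem_product, mem_range]

theorem inversions_eq_empty_of_monotoneOn {n : ℕ} {p : ℕ → ℕ} (hp : MonotoneOn p (Set.Iio n)) :
    inversions n p = ∅ := by
  refine eq_empty_of_forall_notMem fun x hx => ?_
  obtain ⟨⟨h₁, h₂⟩, hlt, hinv⟩ := mem_inversions.1 hx
  exact hinv.not_ge (hp h₁ h₂ hlt.le)

theorem card_inversions_of_strictAntiOn {n : ℕ} {p : ℕ → ℕ} (hp : StrictAntiOn p (Set.Iio n)) :
    #(inversions n p) = n.choose 2 := by
  have hall : inversions n p = {x ∈ range n ×ˢ range n | x.1 < x.2} := by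
    ext x
    simp only [mem_inversions, mem_filter, mem_product, mem_range]
    exact ⟨fun h => ⟨h.1, h.2.1⟩, fun h => ⟨h.1, h.2, hp h.1.1 h.1.2 h.2⟩⟩
  have hcol : ∀ j ∈ range n, {i ∈ range n | i < j} = range j := by
    intro j hj
    ext i
    simp only [mem_filter, mem_range] at hj ⊢
    omega
  rw [hall, card_filter, sum_product_right, Nat.choose_two_right, ← sum_range_id]
  refine sum_congr rfl fun j hj => ?_
  rw [← card_filter, hcol j hj, card_range]

theorem card_inversions_le_add_one {n j : ℕ} {p q : ℕ → ℕ} (hp : Set.InjOn p (Set.Iio n))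
    (hpq : ∀ a < n, q a = p a ∨ (p a = j ∨ p a = j + 1) ∧ (q a = j ∨ q a = j + 1)) :
    #(inversions n q) ≤ #(inversions n p) + 1 := by
  have hnew : ∀ x ∈ inversions n q \ inversions n p, (x.1 < n ∧ p x.1 = j) ∧
      (x.2 < n ∧ p x.2 = j + 1) := by
    intro x hx
    rw [mem_sdiff, mem_inversions, mem_inversions] at hx
    have hne : p x.1 ≠ p x.2 := fun h => hx.1.2.1.ne (hp hx.1.1.1 hx.1.1.2 h)
    have h₁ := hpq x.1 hx.1.1.1
    have h₂ := hpq x.2 hx.1.1.2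
    omega
  have hone : #(inversions n q \ inversions n p) ≤ 1 := by
    refine card_le_one.2 fun x hx y hy => ?_
    obtain ⟨⟨hx₁, hpx₁⟩, hx₂, hpx₂⟩ := hnew x hx
    obtain ⟨⟨hy₁, hpy₁⟩, hy₂, hpy₂⟩ := hnew y hy
    exact Prod.ext (hp hx₁ hy₁ (hpx₁.trans hpy₁.symm)) (hp hx₂ hy₂ (hpx₂.trans hpy₂.symm))
  have := card_le_card_sdiff_add_card (s := inversions n q) (t := inversions n p)
  omega

end Inversions

theorem sInf_eq_or_of_forall_ne_mem_iff {A A' : Set ℕ} (hA : IsUpperSet A) (hA' : IsUpperSet A')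
    {j : ℕ} (h : ∀ k ≠ j, (k ∈ A ↔ k ∈ A')) :
    sInf A' = sInf A ∨ (sInf A = j ∨ sInf A = j + 1) ∧ (sInf A' = j ∨ sInf A' = j + 1) := by
  wlog hlt : sInf A < sInf A' generalizing A A'
  · rcases (not_lt.1 hlt).eq_or_lt with heq | hgt
    · exact Or.inl heq
    · exact (this hA' hA (fun k hk => (h k hk).symm) hgt).imp Eq.symm And.symm
  obtain ⟨m, hm⟩ := Nat.nonempty_of_pos_sInf (pos_of_gt hlt)
  have hmem : sInf A ∈ A :=
    Nat.sInf_mem ⟨m + j + 1, (h _ (by omega)).2 (hA' (by omega) hm)⟩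
  have hj : sInf A = j := by
    by_contra hne
    exact Nat.notMem_of_lt_sInf hlt ((h _ hne).1 hmem)
  have hle : sInf A' ≤ j + 1 := Nat.sInf_le ((h _ (by omega)).1 (hA (by omega) hmem))
  omega

/-! ### The relative position of two complete flags -/

section RelativePosition

variable {L : Type*} [Lattice L]

/-- The position of the flag `E` relative to the `i`-th step `C i ≤ C (i + 1)` of the flag `C`: the
first index `k` for which `E k` meets `C (i + 1)` outside of `C i`. For two complete flags of length
`n`, these positions for `i < n` form a permutation of `{1, …, n}`. -/
noncomputable def relPos (C E : ℕ → L) (i : ℕ) : ℕ :=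
  sInf {k | ¬ E k ⊓ C (i + 1) ≤ C i}

/-- The number of inversions of the relative position of two flags of length `n`. -/
noncomputable def relInversions (n : ℕ) (C E : ℕ → L) : ℕ :=
  (inversions n (relPos C E)).card

variable {C E E' : ℕ → L} {i k n : ℕ} {a : L}

theorem isUpperSet_setOf_not_inf_le (hE : Monotone E) (x y : L) :
    IsUpperSet {k | ¬ E k ⊓ x ≤ y} :=
  fun _ _ hkm hk hm => hk ((inf_le_inf_right x (hE hkm)).trans hm)

theorem relPos_eq_succ (hE : Monotone E) (hk : E k ⊓ C (i + 1) ≤ C i)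
    (hk' : ¬ E (k + 1) ⊓ C (i + 1) ≤ C i) : relPos C E i = k + 1 := by
  refine (Nat.sInf_le hk').antisymm (le_csInf ⟨_, hk'⟩ fun m hm => ?_)
  by_contra! hmk
  exact isUpperSet_setOf_not_inf_le hE _ _ (Nat.le_of_lt_succ hmk) hm hk

theorem relPos_eq_or_of_forall_ne_eq {j : ℕ} (hE : Monotone E) (hE' : Monotone E')
    (h : ∀ k ≠ j, E k = E' k) (i : ℕ) :
    relPos C E' i = relPos C E i ∨ (relPos C E i = j ∨ relPos C E i = j + 1) ∧
      (relPos C E' i = j ∨ relPos C E' i = j + 1) :=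
  sInf_eq_or_of_forall_ne_mem_iff (isUpperSet_setOf_not_inf_le hE _ _)
    (isUpperSet_setOf_not_inf_le hE' _ _) fun k hk => by simp only [Set.mem_ofPred_eq, h k hk]

variable [OrderBot L]

/-- `E 0, …, E n` is a saturated chain from `⊥` to `a`. Only the terms of index at most `n` matter,
but `E` is monotone on all of `ℕ` so that indices need not be bounded. -/
structure IsCompleteFlag (E : ℕ → L) (n : ℕ) (a : L) : Prop where
  monotone : Monotone E
  apply_zero : E 0 = ⊥
  apply_last : E n = a
  covBy : ∀ k < n, E k ⋖ E (k + 1)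

theorem exists_relPos_eq_succ (hC : IsCompleteFlag C n a) (hE : IsCompleteFlag E n a)
    (hi : i < n) :
    ∃ k < n, relPos C E i = k + 1 ∧ E k ⊓ C (i + 1) ≤ C i ∧ ¬ E (k + 1) ⊓ C (i + 1) ≤ C i := by
  have hn : ¬ E n ⊓ C (i + 1) ≤ C i := by
    rw [hE.apply_last, ← hC.apply_last, inf_eq_right.2 (hC.monotone hi)]
    exact (hC.covBy i hi).lt.not_ge
  have hmem : ¬ E (relPos C E i) ⊓ C (i + 1) ≤ C i :=
    Nat.sInf_mem (s := {k | ¬ E k ⊓ C (i + 1) ≤ C i}) ⟨n, hn⟩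
  have hle : relPos C E i ≤ n := Nat.sInf_le hn
  rcases hpos : relPos C E i with _ | k
  · rw [hpos, hE.apply_zero, bot_inf_eq] at hmem
    exact absurd bot_le hmem
  · have hk : k < sInf {k | ¬ E k ⊓ C (i + 1) ≤ C i} := by
      rw [← relPos, hpos]
      exact k.lt_succ_self
    exact ⟨k, by omega, rfl, not_not.1 (Nat.notMem_of_lt_sInf hk), hpos ▸ hmem⟩

theorem relInversions_self (hC : IsCompleteFlag C n a) : relInversions n C C = 0 := by
  have hpos : ∀ i < n, relPos C C i = i + 1 := fun i hi =>
    relPos_eq_succ hC.monotone inf_le_left (by rw [inf_idem]; exact (hC.covBy i hi).lt.not_ge)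
  rw [relInversions, inversions_eq_empty_of_monotoneOn, Finset.card_empty]
  intro i hi j hj hij
  rw [hpos i hi, hpos j hj]
  omega

variable [IsModularLattice L]

theorem relPos_ne_of_lt (hC : IsCompleteFlag C n a) (hE : IsCompleteFlag E n a) {j : ℕ}
    (hij : i < j) (hj : j < n) : relPos C E i ≠ relPos C E j := by
  intro heq
  obtain ⟨k, hkn, hki, hle_i, hnot_i⟩ := exists_relPos_eq_succ hC hE (hij.trans hj)
  obtain ⟨k', -, hkj, hle_j, hnot_j⟩ := exists_relPos_eq_succ hC hE hj
  obtain rfl : k = k' := by omega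
  set x := E (k + 1) ⊓ C (i + 1)
  have hxC : x ≤ C j := inf_le_right.trans (hC.monotone hij)
  have hxE : ¬ x ≤ E k := fun h => hnot_i ((le_inf h inf_le_right).trans hle_i)
  -- As `E k ⋖ E (k + 1)`, the new element `x` already accounts for the whole step from `E k`.
  have hsup : E k ⊔ x = E (k + 1) :=
    ((hE.covBy k hkn).eq_or_eq le_sup_left
      (sup_le (hE.monotone k.le_succ) inf_le_left)).resolve_left (left_lt_sup.2 hxE).ne'
  refine hnot_j ?_
  calc E (k + 1) ⊓ C (j + 1) = (x ⊔ E k) ⊓ C (j + 1) := by rw [← hsup, sup_comm]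
    _ = x ⊔ E k ⊓ C (j + 1) := sup_inf_assoc_of_le _ (hxC.trans (hC.monotone j.le_succ))
    _ ≤ C j := sup_le hxC hle_j

theorem injOn_relPos (hC : IsCompleteFlag C n a) (hE : IsCompleteFlag E n a) :
    Set.InjOn (relPos C E) (Set.Iio n) := by
  intro i hi j hj heq
  rcases lt_trichotomy i j with hij | rfl | hji
  · exact absurd heq (relPos_ne_of_lt hC hE hij hj)
  · rfl
  · exact absurd heq.symm (relPos_ne_of_lt hC hE hji hi)

theorem relInversions_le_add_one (hC : IsCompleteFlag C n a) (hE : IsCompleteFlag E n a)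
    (hE' : Monotone E') {j : ℕ} (h : ∀ k ≠ j, E k = E' k) :
    relInversions n C E' ≤ relInversions n C E + 1 :=
  card_inversions_le_add_one (injOn_relPos hC hE) fun i _ =>
    relPos_eq_or_of_forall_ne_eq hE.monotone hE' h i

theorem relInversions_of_complementary (hC : IsCompleteFlag C n a) (hE : Monotone E)
    (hdisj : ∀ k ≤ n, Disjoint (C k) (E (n - k))) (hsup : ∀ k ≤ n, C k ⊔ E (n - k) = a) :
    relInversions n C E = n.choose 2 := by
  have hpos : ∀ i < n, relPos C E i = n - (i + 1) + 1 := by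
    intro i hi
    refine relPos_eq_succ hE ?_ fun hle => (hC.covBy i hi).lt.not_ge ?_
    · rw [(hdisj (i + 1) hi).symm.eq_bot]
      exact bot_le
    · rw [show n - (i + 1) + 1 = n - i by omega] at hle
      calc C (i + 1) = (C i ⊔ E (n - i)) ⊓ C (i + 1) := by
            rw [hsup i hi.le, ← hC.apply_last, inf_eq_right.2 (hC.monotone hi)]
        _ = C i ⊔ E (n - i) ⊓ C (i + 1) := sup_inf_assoc_of_le _ (hC.monotone i.le_succ)
        _ ≤ C i := sup_le le_rfl hle
  refine card_inversions_of_strictAntiOn fun i hi j hj hij => ?_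
  rw [hpos i hi, hpos j hj]
  rw [Set.mem_Iio] at hi hj
  omega

end RelativePosition

/-! ### Absolute length and maximal chains of non-crossing partitions -/

section AbsoluteOrder

open CoxeterSystem

variable {B W : Type*} [Group W] {M : CoxeterMatrix B} (cs : CoxeterSystem M W)

theorem absLength_conj_le (g w : W) : cs.absLength (g * w * g⁻¹) ≤ cs.absLength w := by
  obtain ⟨l, hl, rfl, hlen⟩ := cs.exists_absLength w
  rw [← hlen, ← MulAut.conj_apply, map_list_prod, ← List.length_map (MulAut.conj g)]
  refine cs.absLength_prod_le _ fun t ht => ?_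
  obtain ⟨r, hr, rfl⟩ := List.mem_map.1 ht
  exact (hl r hr).conj g

theorem absLength_conj (g w : W) : cs.absLength (g * w * g⁻¹) = cs.absLength w := by
  refine (absLength_conj_le cs g w).antisymm ?_
  simpa [mul_assoc] using absLength_conj_le cs g⁻¹ (g * w * g⁻¹)

theorem absLength_wordProd_le (l : List B) : cs.absLength (cs.wordProd l) ≤ l.length := by
  rw [← List.length_map cs.simple]
  refine cs.absLength_prod_le _ fun t ht => ?_
  obtain ⟨i, -, rfl⟩ := List.mem_map.1 ht
  exact cs.isReflection_simple i

theorem one_absLE (w : W) : cs.AbsLE 1 w := by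
  simp [AbsLE, absLength_one]

variable {cs} {c v w : W}

theorem eq_of_absLE_of_absLength_le (h : cs.AbsLE v w) (hle : cs.absLength w ≤ cs.absLength v) :
    v = w := by
  unfold AbsLE at h
  exact inv_mul_eq_one.1 (cs.eq_one_of_absLength_eq_zero (by omega))

theorem exists_absLE_absLength_eq_add_one (h : cs.AbsLE v w)
    (hlt : cs.absLength v < cs.absLength w) :
    ∃ y, cs.AbsLE v y ∧ cs.AbsLE y w ∧ cs.absLength y = cs.absLength v + 1 := by
  obtain ⟨l, hl, hprod, hlen⟩ := cs.exists_absLength (v⁻¹ * w)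
  unfold AbsLE at *
  rcases l with _ | ⟨t, l⟩
  · rw [List.length_nil] at hlen
    omega
  rw [List.forall_mem_cons] at hl
  rw [List.length_cons] at hlen
  have hvt : v⁻¹ * (v * t) = t := inv_mul_cancel_left v t
  have hrest : (v * t)⁻¹ * w = l.prod := by
    rw [mul_inv_rev, mul_assoc, ← hprod, List.prod_cons, inv_mul_cancel_left]
  have ht : cs.absLength t ≤ 1 := by
    simpa using cs.absLength_prod_le [t] (by simpa using hl.1)
  have hvt_le := cs.absLength_mul_le v t
  have hl_le := cs.absLength_prod_le l hl.2
  have hw_le := cs.absLength_mul_le (v * t) ((v * t)⁻¹ * w)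
  rw [mul_inv_cancel_left, hrest] at hw_le
  refine ⟨v * t, ?_, ?_, ?_⟩
  · rw [hvt]
    omega
  · rw [hrest]
    omega
  · omega

theorem inv_mul_absLE_inv_mul (hvw : cs.AbsLE v w) (hwc : cs.AbsLE w c) :
    cs.AbsLE (w⁻¹ * c) (v⁻¹ * c) := by
  have hvc := hvw.trans cs hwc
  have hconj : cs.absLength ((w⁻¹ * c)⁻¹ * (v⁻¹ * c)) = cs.absLength (v⁻¹ * w) := by
    rw [← absLength_conj cs (c⁻¹ * w) (v⁻¹ * w)]
    congr 1
    group
  unfold AbsLE at *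
  omega

theorem inv_mul_absLE (h : cs.AbsLE v c) : cs.AbsLE (v⁻¹ * c) c := by
  simpa using inv_mul_absLE_inv_mul (one_absLE cs v) h

instance : BoundedOrder (cs.NC c) where
  bot := ⟨1, one_absLE cs c⟩
  bot_le x := one_absLE cs x.1
  top := ⟨c, AbsLE.rfl cs c⟩
  le_top x := x.2

theorem le_of_mem_flag_of_absLength_le (F : Flag (cs.NC c)) {x y : cs.NC c} (hx : x ∈ F)
    (hy : y ∈ F) (h : cs.absLength x.1 ≤ cs.absLength y.1) : x ≤ y := by
  rcases F.le_or_le hx hy with hxy | hyx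
  · exact hxy
  · have heq : y = x := Subtype.ext (eq_of_absLE_of_absLength_le hyx h)
    exact heq.ge

theorem exists_mem_flag_absLength_eq (F : Flag (cs.NC c)) {k : ℕ} (hk : k ≤ cs.absLength c) :
    ∃ x ∈ F, cs.absLength x.1 = k := by
  induction k with
  | zero => exact ⟨⊥, F.bot_mem, cs.absLength_one⟩
  | succ k ih =>
    obtain ⟨x, hxF, hx⟩ := ih (by omega)
    obtain ⟨z, ⟨hzF, hz⟩, hzmin⟩ := exists_minimalFor_of_wellFoundedLT
      (fun z : cs.NC c => z ∈ F ∧ k < cs.absLength z.1) (fun z => cs.absLength z.1)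
      ⟨⊤, F.top_mem, hk⟩
    have hxz : x ≤ z := le_of_mem_flag_of_absLength_le F hxF hzF (by omega)
    obtain ⟨y, hxy, hyz, hy⟩ := exists_absLE_absLength_eq_add_one hxz (by omega)
    refine ⟨⟨y, hyz.trans cs z.2⟩, Flag.mem_iff_forall_le_or_ge.2 fun u hu => ?_,
      hy.trans (by rw [hx])⟩
    rcases le_or_gt (cs.absLength u.1) k with huk | hku
    · exact Or.inr (AbsLE.trans cs (le_of_mem_flag_of_absLength_le F hu hxF (by omega)) hxy)
    · have hzu : cs.absLength z.1 ≤ cs.absLength u.1 := by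
        by_contra! hlt
        exact hlt.not_ge (hzmin ⟨hu, hku⟩ hlt.le)
      exact Or.inl (AbsLE.trans cs hyz (le_of_mem_flag_of_absLength_le F hzF hu hzu))

/-- The element of absolute length `k` of a maximal chain, or its top element `c` if `ℓ(c) < k`. -/
noncomputable def flagElt (F : Flag (cs.NC c)) (k : ℕ) : cs.NC c :=
  (exists_mem_flag_absLength_eq F (min_le_right k (cs.absLength c))).choose

theorem flagElt_mem (F : Flag (cs.NC c)) (k : ℕ) : flagElt F k ∈ F :=
  (exists_mem_flag_absLength_eq F (min_le_right k (cs.absLength c))).choose_spec.1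

theorem absLength_flagElt (F : Flag (cs.NC c)) (k : ℕ) :
    cs.absLength (flagElt F k).1 = min k (cs.absLength c) :=
  (exists_mem_flag_absLength_eq F (min_le_right k (cs.absLength c))).choose_spec.2

theorem flagElt_eq (F : Flag (cs.NC c)) {k : ℕ} {x : cs.NC c} (hx : x ∈ F)
    (h : cs.absLength x.1 = min k (cs.absLength c)) : flagElt F k = x :=
  have heq := (absLength_flagElt F k).trans h.symm
  (le_of_mem_flag_of_absLength_le F (flagElt_mem F k) hx heq.le).antisymm
    (le_of_mem_flag_of_absLength_le F hx (flagElt_mem F k) heq.ge)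

theorem flagElt_mono (F : Flag (cs.NC c)) : Monotone (flagElt F) := by
  intro k m hkm
  refine le_of_mem_flag_of_absLength_le F (flagElt_mem F k) (flagElt_mem F m) ?_
  rw [absLength_flagElt, absLength_flagElt]
  exact min_le_min_right _ hkm

theorem flagElt_zero (F : Flag (cs.NC c)) : flagElt F 0 = ⊥ :=
  flagElt_eq F F.bot_mem (by rw [Nat.zero_min]; exact cs.absLength_one)

theorem flagElt_absLength (F : Flag (cs.NC c)) : flagElt F (cs.absLength c) = ⊤ :=
  flagElt_eq F F.top_mem (min_self _).symm

theorem exists_forall_ne_flagElt_eq_of_adj {F F' : Flag (cs.NC c)}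
    (h : (cs.hurwitzGraph c).Adj F F') : ∃ j, ∀ k ≠ j, flagElt F k = flagElt F' k := by
  obtain ⟨x, hx⟩ := Set.ncard_eq_one.1 h.1
  have hxF' : x ∉ F' := (hx.symm ▸ Set.mem_singleton x : x ∈ (F : Set (cs.NC c)) \ F').2
  have hxc : cs.absLength x.1 ≠ cs.absLength c := fun hxc =>
    hxF' ((Subtype.ext (eq_of_absLE_of_absLength_le x.2 hxc.ge) : x = ⊤) ▸ F'.top_mem)
  refine ⟨cs.absLength x.1, fun k hk => ?_⟩
  have hkF' : flagElt F k ∈ F' := by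
    by_contra hkF'
    have hkx : flagElt F k ∈ ({x} : Set (cs.NC c)) := hx ▸ ⟨flagElt_mem F k, hkF'⟩
    have hlen := absLength_flagElt F k
    rw [hkx] at hlen
    omega
  exact (flagElt_eq F' hkF' (absLength_flagElt F k)).symm

theorem exists_flag_flagElt_eq_inv_mul (F : Flag (cs.NC c)) :
    ∃ F' : Flag (cs.NC c), ∀ k ≤ cs.absLength c,
      (flagElt F' (cs.absLength c - k)).1 = (flagElt F k).1⁻¹ * c := by
  let kreweras (x : cs.NC c) : cs.NC c := ⟨x.1⁻¹ * c, inv_mul_absLE x.2⟩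
  have hanti : Antitone kreweras := fun x y hxy => inv_mul_absLE_inv_mul hxy y.2
  have hchain : IsChain (· ≤ ·) (kreweras '' F) := by
    rintro _ ⟨x, hx, rfl⟩ _ ⟨y, hy, rfl⟩ -
    exact (F.le_or_le hx hy).symm.imp (hanti ·) (hanti ·)
  obtain ⟨F', hF'⟩ := hchain.exists_subset_flag
  refine ⟨F', fun k hk => ?_⟩
  rw [flagElt_eq F' (hF' (Set.mem_image_of_mem _ (flagElt_mem F k)))]
  have hlen := absLength_flagElt F k
  have hle : cs.absLength c = _ + cs.absLength ((flagElt F k).1⁻¹ * c) := (flagElt F k).2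
  change cs.absLength ((flagElt F k).1⁻¹ * c) = _
  omega

end AbsoluteOrder

section Moved

variable {R G V : Type*} [Ring R] [Group G] [AddCommGroup V] [Module R V]
  (ρ : Representation R G V)

/-- The moved space of `g`, that is, the range of `ρ g - 1`. -/
def moved (g : G) : Submodule R V := LinearMap.range (ρ g - 1)

theorem moved_one : moved ρ 1 = ⊥ := by
  simp [moved]

theorem moved_mul_le (g h : G) : moved ρ (g * h) ≤ moved ρ g ⊔ moved ρ h := by
  rintro _ ⟨x, rfl⟩
  exact Submodule.mem_sup.2 ⟨_, ⟨ρ h x, rfl⟩, _, ⟨x, rfl⟩, by simp⟩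

theorem moved_conj (g h : G) : moved ρ (g * h * g⁻¹) = (moved ρ h).map (ρ g) := by
  apply le_antisymm
  · rintro _ ⟨x, rfl⟩
    exact ⟨_, ⟨ρ g⁻¹ x, rfl⟩, by simp⟩
  · rintro _ ⟨_, ⟨x, rfl⟩, rfl⟩
    exact ⟨ρ g x, by simp⟩

theorem finrank_moved_conj (g h : G) :
    finrank R (moved ρ (g * h * g⁻¹)) = finrank R (moved ρ h) := by
  rw [moved_conj]
  exact (LinearEquiv.ofBijective (ρ g) (ρ.apply_bijective g)).finrank_map_eq (moved ρ h)

end Moved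

theorem covBy_of_finrank_eq_add_one {K V : Type*} [DivisionRing K] [AddCommGroup V] [Module K V]
    [FiniteDimensional K V] {P Q : Submodule K V} (hle : P ≤ Q)
    (h : finrank K Q = finrank K P + 1) : P ⋖ Q := by
  refine ⟨hle.lt_of_ne ?_, fun U hPU hUQ => ?_⟩
  · rintro rfl
    omega
  · have := Submodule.finrank_lt_finrank_of_lt hPU
    have := Submodule.finrank_lt_finrank_of_lt hUQ
    omega

theorem coe_le_coe_add_edist {α : Type*} {G : SimpleGraph α} {f : α → ℕ}
    (hf : ∀ u v, G.Adj u v → f v ≤ f u + 1) (u v : α) : (f v : ℕ∞) ≤ f u + G.edist u v := by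
  have hwalk : ∀ {u v : α} (p : G.Walk u v), f v ≤ f u + p.length := by
    intro u v p
    induction p with
    | nil => exact le_rfl
    | cons hadj p ih =>
      have := hf _ _ hadj
      rw [SimpleGraph.Walk.length_cons]
      omega
  by_cases htop : G.edist u v = ⊤
  · simp [htop]
  · obtain ⟨p, hp⟩ := SimpleGraph.exists_walk_of_edist_ne_top htop
    rw [← hp]
    exact_mod_cast hwalk p

/-! ### The flag of moved spaces of a maximal chain -/

section MovedFlag

open CoxeterSystem

variable {B W : Type*} [Group W] {M : CoxeterMatrix B} {cs : CoxeterSystem M W} {c v w : W}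
  {K V : Type*} [DivisionRing K] [AddCommGroup V] [Module K V] {ρ : Representation K W V}

/-- The sequence of moved spaces of the elements of a maximal chain of non-crossing partitions,
indexed by absolute length. -/
noncomputable def movedFlag (ρ : Representation K W V) (F : Flag (cs.NC c)) (k : ℕ) :
    Submodule K V :=
  moved ρ (flagElt F k).1

variable [FiniteDimensional K V]

theorem finrank_moved_le_absLength (hρ : ∀ i, finrank K (moved ρ (cs.simple i)) ≤ 1) (w : W) :
    finrank K (moved ρ w) ≤ cs.absLength w := by
  obtain ⟨l, hl, rfl, hlen⟩ := cs.exists_absLength w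
  rw [← hlen]
  clear hlen
  induction l with
  | nil => rw [List.prod_nil, moved_one, finrank_bot, List.length_nil]
  | cons t l ih =>
    rw [List.forall_mem_cons] at hl
    have ht : finrank K (moved ρ t) ≤ 1 := by
      obtain ⟨g, i, rfl⟩ := hl.1
      rw [finrank_moved_conj]
      exact hρ i
    calc finrank K (moved ρ (t * l.prod))
        ≤ finrank K (moved ρ t ⊔ moved ρ l.prod : Submodule K V) :=
          Submodule.finrank_mono (moved_mul_le ρ _ _)
      _ ≤ finrank K (moved ρ t) + finrank K (moved ρ l.prod) :=
          Submodule.finrank_add_le_finrank_add_finrank _ _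
      _ ≤ (t :: l).length := by
          have := ih hl.2
          rw [List.length_cons]
          omega

theorem moved_of_absLE (hρ : ∀ i, finrank K (moved ρ (cs.simple i)) ≤ 1) (h : cs.AbsLE v w)
    (hw : finrank K (moved ρ w) = cs.absLength w) :
    finrank K (moved ρ v) = cs.absLength v ∧
      moved ρ v ⊔ moved ρ (v⁻¹ * w) = moved ρ w ∧ Disjoint (moved ρ v) (moved ρ (v⁻¹ * w)) := by
  have hv_le := finrank_moved_le_absLength hρ v
  have hvw_le := finrank_moved_le_absLength hρ (v⁻¹ * w)
  have hle : moved ρ w ≤ moved ρ v ⊔ moved ρ (v⁻¹ * w) := by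
    simpa using moved_mul_le ρ v (v⁻¹ * w)
  have hfin_le := Submodule.finrank_mono hle
  have hfin := Submodule.finrank_sup_add_finrank_inf_eq (moved ρ v) (moved ρ (v⁻¹ * w))
  unfold AbsLE at h
  refine ⟨by omega, (Submodule.eq_of_le_of_finrank_le hle (by omega)).symm, ?_⟩
  exact disjoint_iff.2 (Submodule.finrank_eq_zero.1 (by omega))

variable (hρ : ∀ i, finrank K (moved ρ (cs.simple i)) ≤ 1)
  (hc : finrank K (moved ρ c) = cs.absLength c)

include hρ hc

theorem finrank_movedFlag (F : Flag (cs.NC c)) (k : ℕ) :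
    finrank K (movedFlag ρ F k) = min k (cs.absLength c) := by
  rw [movedFlag, (moved_of_absLE hρ (flagElt F k).2 hc).1, absLength_flagElt]

theorem isCompleteFlag_movedFlag (F : Flag (cs.NC c)) :
    IsCompleteFlag (movedFlag ρ F) (cs.absLength c) (moved ρ c) := by
  have hmono : Monotone (movedFlag ρ F) := fun k m hkm =>
    have hm := (moved_of_absLE hρ (flagElt F m).2 hc).1
    le_sup_left.trans_eq (moved_of_absLE hρ (flagElt_mono F hkm) hm).2.1
  refine ⟨hmono, ?_, ?_, fun k hk => covBy_of_finrank_eq_add_one (hmono k.le_succ) ?_⟩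
  · rw [movedFlag, flagElt_zero]
    exact moved_one ρ
  · rw [movedFlag, flagElt_absLength]
    rfl
  · rw [finrank_movedFlag hρ hc, finrank_movedFlag hρ hc]
    omega

theorem relInversions_movedFlag_le_add_one_of_adj (C : Flag (cs.NC c)) {F F' : Flag (cs.NC c)}
    (h : (cs.hurwitzGraph c).Adj F F') :
    relInversions (cs.absLength c) (movedFlag ρ C) (movedFlag ρ F') ≤
      relInversions (cs.absLength c) (movedFlag ρ C) (movedFlag ρ F) + 1 := by
  obtain ⟨j, hj⟩ := exists_forall_ne_flagElt_eq_of_adj h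
  exact relInversions_le_add_one (isCompleteFlag_movedFlag hρ hc C)
    (isCompleteFlag_movedFlag hρ hc F) (isCompleteFlag_movedFlag hρ hc F').monotone
    fun k hk => by rw [movedFlag, movedFlag, hj k hk]

theorem exists_relInversions_movedFlag_eq_choose_two (C : Flag (cs.NC c)) :
    ∃ F : Flag (cs.NC c), relInversions (cs.absLength c) (movedFlag ρ C) (movedFlag ρ F) =
      (cs.absLength c).choose 2 := by
  obtain ⟨F, hF⟩ := exists_flag_flagElt_eq_inv_mul C
  have hcompl : ∀ k ≤ cs.absLength c,
      movedFlag ρ F (cs.absLength c - k) = moved ρ ((flagElt C k).1⁻¹ * c) := fun k hk => by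
    rw [movedFlag, hF k hk]
  refine ⟨F, relInversions_of_complementary (isCompleteFlag_movedFlag hρ hc C)
    (isCompleteFlag_movedFlag hρ hc F).monotone (fun k hk => ?_) fun k hk => ?_⟩
  · rw [hcompl k hk]
    exact (moved_of_absLE hρ (flagElt C k).2 hc).2.2
  · rw [hcompl k hk]
    exact (moved_of_absLE hρ (flagElt C k).2 hc).2.1

theorem choose_two_absLength_le_radius_hurwitzGraph :
    ((cs.absLength c).choose 2 : ℕ∞) ≤ (cs.hurwitzGraph c).radius := by
  refine le_iInf fun C => ?_
  obtain ⟨F, hF⟩ := exists_relInversions_movedFlag_eq_choose_two hρ hc C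
  calc ((cs.absLength c).choose 2 : ℕ∞)
      = relInversions (cs.absLength c) (movedFlag ρ C) (movedFlag ρ F) := by rw [hF]
    _ ≤ relInversions (cs.absLength c) (movedFlag ρ C) (movedFlag ρ C) +
          (cs.hurwitzGraph c).edist C F :=
        coe_le_coe_add_edist (f := fun F => relInversions _ (movedFlag ρ C) (movedFlag ρ F))
          (fun _ _ => relInversions_movedFlag_le_add_one_of_adj hρ hc C) C F
    _ = (cs.hurwitzGraph c).edist C F := by
        rw [relInversions_self (isCompleteFlag_movedFlag hρ hc C), Nat.cast_zero, zero_add]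
    _ ≤ (cs.hurwitzGraph c).eccent C := SimpleGraph.edist_le_eccent

end MovedFlag

/-! ### The order of the product of two reflections -/

section Dihedral

open Polynomial.Chebyshev Real

theorem eval_S_eq_zero_of_sin_eq_zero {θ : ℝ} (hθ : sin θ ≠ 0) {k : ℤ}
    (h : sin ((k + 1) * θ) = 0) : (S ℝ k).eval (2 * cos θ) = 0 := by
  rw [← S_two_mul_real_cos] at h
  exact (mul_eq_zero.1 h).resolve_right hθ

theorem eval_S_add_eval_S_eq_zero_of_sin_add_sin_eq_zero {θ : ℝ} (hθ : sin θ ≠ 0) {k l : ℤ}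
    (h : sin ((k + 1) * θ) + sin ((l + 1) * θ) = 0) :
    (S ℝ k).eval (2 * cos θ) + (S ℝ l).eval (2 * cos θ) = 0 := by
  rw [← S_two_mul_real_cos, ← S_two_mul_real_cos, ← add_mul] at h
  exact (mul_eq_zero.1 h).resolve_right hθ

variable {V : Type*} [AddCommGroup V] [Module ℝ V] {x y : V} {f g : Dual ℝ V}

theorem reflection_mul_reflection_pow_eq_one_of_sin_ne_zero (hf : f x = 2) (hg : g y = 2) {m : ℕ}
    {θ : ℝ} (hθ : sin θ ≠ 0) (hmθ : m * θ = 2 * π) (hfg : f y * g x - 2 = 2 * cos θ) :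
    (reflection hf * reflection hg) ^ m = 1 := by
  ext z
  rw [reflection_mul_reflection_pow_apply hf hg m z, hfg]
  obtain ⟨k, rfl | rfl⟩ := m.even_or_odd'
  · have hS : (S ℝ ((k : ℤ) - 1)).eval (2 * cos θ) = 0 := by
      refine eval_S_eq_zero_of_sin_eq_zero hθ ?_
      rw [← sin_pi]
      congr 1
      push_cast at hmθ ⊢
      linarith
    rw [show (((2 * k : ℕ) : ℤ) - 2) / 2 = k - 1 by omega,
      show (((2 * k : ℕ) : ℤ) - 1) / 2 = k - 1 by omega, hS]
    simp
  · have hS : (S ℝ (k : ℤ)).eval (2 * cos θ) + (S ℝ ((k : ℤ) - 1)).eval (2 * cos θ) = 0 := by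
      refine eval_S_add_eval_S_eq_zero_of_sin_add_sin_eq_zero hθ ?_
      rw [show ((((k : ℤ) - 1 : ℤ) : ℝ) + 1) * θ = 2 * π - (((k : ℤ) : ℝ) + 1) * θ by
        push_cast at hmθ ⊢
        linarith, sin_two_pi_sub, add_neg_cancel]
    rw [show (((2 * k + 1 : ℕ) : ℤ) - 2) / 2 = k - 1 by omega,
      show (((2 * k + 1 : ℕ) : ℤ) - 1) / 2 = k by omega,
      show (((2 * k + 1 : ℕ) : ℤ) - 3) / 2 = k - 1 by omega,
      show ((2 * k + 1 : ℕ) : ℤ) / 2 = k by omega, hS]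
    simp

theorem reflection_mul_reflection_pow_eq_one (hf : f x = 2) (hg : g y = 2) {m : ℕ} (hm : 2 ≤ m)
    (hfy : f y = -2 * cos (π / m)) (hgx : g x = -2 * cos (π / m)) :
    (reflection hf * reflection hg) ^ m = 1 := by
  obtain rfl | hm3 := hm.eq_or_lt
  · rw [Nat.cast_ofNat, cos_pi_div_two, mul_zero] at hfy hgx
    ext z
    simp only [pow_two, LinearEquiv.mul_apply, LinearEquiv.coe_one, id, reflection_apply, map_sub,
      map_smul, hf, hg, hfy, hgx]
    module
  have hm3' : (3 : ℝ) ≤ m := by exact_mod_cast hm3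
  have hmθ : m * (2 * (π / m)) = 2 * π := by field_simp
  refine reflection_mul_reflection_pow_eq_one_of_sin_ne_zero hf hg ?_ hmθ ?_
  · refine (sin_pos_of_pos_of_lt_pi (by positivity) ?_).ne'
    nlinarith [pi_pos]
  · rw [hfy, hgx, cos_two_mul]
    ring

end Dihedral

/-! ### Realizations of a Coxeter matrix -/

section Realization

open CoxeterSystem Real

/-- A realization of a Coxeter matrix in the sense of Kac: roots and coroots that pair as in the
geometric representation, with linearly independent roots and with coroots that take arbitrary
prescribed values (for finite `B`, this is linear independence of the coroots). An infinite label
is encoded by `M i j = 0`, for which `π / 0 = 0` gives the customary pairing `-2`. -/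
structure Realization {B : Type*} (M : CoxeterMatrix B) (V : Type*) [AddCommGroup V]
    [Module ℝ V] where
  root : B → V
  coroot : B → Dual ℝ V
  coroot_root : ∀ i j, coroot i (root j) = -2 * cos (π / M i j)
  linearIndependent_root : LinearIndependent ℝ root
  surjective_coroot : Function.Surjective (LinearMap.pi coroot)

namespace Realization

variable {B W : Type*} [Group W] {M : CoxeterMatrix B} (cs : CoxeterSystem M W)

/-- The realization obtained from the geometric representation on `B → ℝ` by adjoining a second copy
of `B → ℝ`, on which the coroots restrict to the coordinate functions. -/
noncomputable def double [Fintype B] [DecidableEq B] (M : CoxeterMatrix B) :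
    Realization M ((B → ℝ) × (B → ℝ)) where
  root j := (Pi.single j 1, 0)
  coroot i := LinearMap.proj i ∘ₗ
    (Matrix.toLin' (Matrix.of fun i j => -2 * cos (π / M i j))).coprod LinearMap.id
  coroot_root i j := by simp
  linearIndependent_root :=
    (Pi.linearIndependent_single_one B ℝ).map' (LinearMap.inl ℝ (B → ℝ) (B → ℝ))
      (LinearMap.ker_eq_bot.2 LinearMap.inl_injective)
  surjective_coroot u := ⟨(0, u), by ext; simp⟩

variable {V : Type*} [AddCommGroup V] [Module ℝ V] (R : Realization M V)

theorem coroot_root_self (i : B) : R.coroot i (R.root i) = 2 := by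
  simp [R.coroot_root]

theorem isLiftable_reflection : M.IsLiftable fun i => reflection (R.coroot_root_self i) := by
  intro i j
  rcases eq_or_ne i j with rfl | hij
  · rw [M.diagonal, pow_one]
    exact inv_mul_cancel (reflection (R.coroot_root_self i))
  have hne := M.off_diagonal i j hij
  obtain hzero | htwo : M i j = 0 ∨ 2 ≤ M i j := by omega
  · rw [hzero, pow_zero]
  · refine reflection_mul_reflection_pow_eq_one _ _ htwo (R.coroot_root i j) ?_
    rw [R.coroot_root, M.symmetric]

/-- The representation of a Coxeter group on a realization in which the simple reflections act as
the reflections of the simple roots and coroots. -/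
noncomputable def rep : Representation ℝ W V :=
  (LinearEquiv.automorphismGroup.toLinearMapMonoidHom).comp
    (cs.lift ⟨_, R.isLiftable_reflection⟩)

theorem rep_simple_apply (i : B) (v : V) :
    R.rep cs (cs.simple i) v = v - R.coroot i v • R.root i := by
  rw [rep, MonoidHom.comp_apply, lift_apply_simple]
  exact reflection_apply v (R.coroot_root_self i)

theorem finrank_moved_simple_le_one (i : B) : finrank ℝ (moved (R.rep cs) (cs.simple i)) ≤ 1 := by
  have hle : moved (R.rep cs) (cs.simple i) ≤ Submodule.span ℝ {R.root i} := by
    rintro _ ⟨v, rfl⟩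
    refine Submodule.mem_span_singleton.2 ⟨-R.coroot i v, ?_⟩
    rw [LinearMap.sub_apply, rep_simple_apply, Module.End.one_apply]
    module
  exact (Submodule.finrank_mono hle).trans
    (by simpa using finrank_span_le_card (R := ℝ) {R.root i})

theorem rep_wordProd_sub_mem_span (l : List B) (v : V) :
    R.rep cs (cs.wordProd l) v - v ∈ Submodule.span ℝ (R.root '' {i | i ∈ l}) := by
  induction l with
  | nil => simp
  | cons i l ih =>
    rw [wordProd_cons, map_mul, Module.End.mul_apply, rep_simple_apply, sub_right_comm]
    refine sub_mem (Submodule.span_mono (Set.image_mono fun j => List.mem_cons_of_mem i) ih) ?_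
    exact Submodule.smul_mem _ _ (Submodule.subset_span ⟨i, List.mem_cons_self, rfl⟩)

theorem coroot_eq_zero_of_rep_wordProd_eq {l : List B} (hl : l.Nodup) {v : V}
    (h : R.rep cs (cs.wordProd l) v = v) : ∀ i ∈ l, R.coroot i v = 0 := by
  induction l with
  | nil => simp
  | cons i l ih =>
    obtain ⟨hil, hl⟩ := List.nodup_cons.1 hl
    have hrest : R.rep cs (cs.wordProd l) v = v - R.coroot i v • R.root i := by
      rw [← rep_simple_apply cs, ← congrArg (R.rep cs (cs.simple i)) h, wordProd_cons,
        ← Module.End.mul_apply, ← map_mul, simple_mul_simple_cancel_left]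
    have hi : R.coroot i v = 0 := by
      by_contra hne
      have hmem := R.rep_wordProd_sub_mem_span cs l v
      rw [hrest, sub_sub_cancel_left, neg_mem_iff, Submodule.smul_mem_iff _ hne] at hmem
      exact R.linearIndependent_root.notMem_span_image hil hmem
    rw [hi, zero_smul, sub_zero] at hrest
    exact List.forall_mem_cons.2 ⟨hi, ih hl hrest⟩

theorem card_le_finrank_moved [Fintype B] [FiniteDimensional ℝ V] {c : W}
    (hc : cs.IsCoxeterElement c) : Fintype.card B ≤ finrank ℝ (moved (R.rep cs) c) := by
  obtain ⟨_, ⟨l, hl, hmem, rfl⟩, hconj⟩ := hc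
  obtain ⟨g, rfl⟩ := isConj_iff.1 hconj
  rw [finrank_moved_conj]
  have hker : LinearMap.ker (R.rep cs (cs.wordProd l) - 1) ≤
      LinearMap.ker (LinearMap.pi R.coroot) := by
    intro v hv
    ext i
    exact R.coroot_eq_zero_of_rep_wordProd_eq cs hl (sub_eq_zero.1 hv) i (hmem i)
  have hcoroot := LinearMap.finrank_range_add_finrank_ker (LinearMap.pi R.coroot)
  rw [LinearMap.range_eq_top.2 R.surjective_coroot, finrank_top,
    finrank_fintype_fun_eq_card] at hcoroot
  have hmoved := LinearMap.finrank_range_add_finrank_ker (R.rep cs (cs.wordProd l) - 1)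
  have := Submodule.finrank_mono hker
  rw [moved]
  omega

end Realization

theorem absLength_le_card_of_isCoxeterElement {B W : Type*} [Fintype B] [Group W]
    {M : CoxeterMatrix B} {cs : CoxeterSystem M W} {c : W} (hc : cs.IsCoxeterElement c) :
    cs.absLength c ≤ Fintype.card B := by
  obtain ⟨_, ⟨l, hl, -, rfl⟩, hconj⟩ := hc
  obtain ⟨g, rfl⟩ := isConj_iff.1 hconj
  rw [absLength_conj]
  exact (absLength_wordProd_le cs l).trans hl.length_le_card

end Realization

end HurwitzGraph

theorem mainTheorem6_general {B W : Type*} [Fintype B] [Group W] {M : CoxeterMatrix B}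
    (cs : CoxeterSystem M W) (c : W) (hc : cs.IsCoxeterElement c) :
    (((Fintype.card B).choose 2 : ℕ) : ℕ∞) ≤ (cs.hurwitzGraph c).radius := by
  classical
  let R := HurwitzGraph.Realization.double M
  have hsimple := R.finrank_moved_simple_le_one cs
  have hcard_le := R.card_le_finrank_moved cs hc
  have hfinrank_le := HurwitzGraph.finrank_moved_le_absLength hsimple c
  have hlength_le := HurwitzGraph.absLength_le_card_of_isCoxeterElement hc
  have hlength : cs.absLength c = Fintype.card B := by omega
  rw [← hlength]
  exact HurwitzGraph.choose_two_absLength_le_radius_hurwitzGraph hsimple (by omega)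

theorem mainTheorem6 {B W : Type*} [Fintype B] [Group W] [Finite W] {M : CoxeterMatrix B}
    (cs : CoxeterSystem M W) (c : W) (hc : cs.IsCoxeterElement c) :
    (((Fintype.card B).choose 2 : ℕ) : ℕ∞) ≤ (cs.hurwitzGraph c).radius :=
  mainTheorem6_general cs c hc
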